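/- Let $\mathcal H$ be a separable complex Hilbert space with identity $I$, let $\Omega\subseteq\mathbb C$ be open and connected, and let $A:\Omega\to\mathcal B(\mathcal H)$ be analytic (in operator norm) with $A(z)$ a Fredholm operator for every $z\in\Omega$. Suppose that $A(z)$ is boundedly invertible for some $z\in\Omega$, and that $z_0\in\Omega$ is a pole of $A(\cdot)^{-1}$ of order $n_0\in\mathbb N$, $n_0\ge 1$. Let $Q_1\in\mathcal B(\mathcal H)$ be any (not necessarily orthogonal) projection, $Q_1^2=Q_1$, with $\operatorname{ran}(Q_1)=\operatorname{ran}(A(z_0))$, and put $P_1=I-Q_1$. Then there is a function $A_1:\Omega\to\mathcal B(\mathcal H)$ such that $$A(z)=[Q_1-(z-z_0)P_1]\,A_1(z),\qquad z\in\Omega,$$ and the following hold. 1. $A_1(\cdot)$ is analytic on $\Omega$. 2. $A_1(z)$ is a Fredholm operator for every $z\in\Omega$. 3. $\operatorname{ind}(A(z))=\operatorname{ind}(A_1(z))=0$ for all $z\in\Omega$ with $|z-z_0|$ sufficiently small. 4. $\operatorname{def}(A_1(z_0))\le\operatorname{def}(A(z_0))$, where $\operatorname{def}(S)=\dim(\operatorname{ran}(S)^{\perp})$.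 5. $z_0$ is a pole of $A_1(\cdot)^{-1}$ of order $n_0-1$ (where a pole of order $0$ means that $A_1(\cdot)^{-1}$, defined on a punctured disk around $z_0$, extends analytically to $z_0$ with a nonzero value there). 6. For every $z\in\Omega$, $I-A(z)$ has finite rank if and only if $I-A_1(z)$ has finite rank. 7. For every $p\in[1,\infty]$ and every $z\in\Omega$, $I-A(z)\in\mathcal B_p(\mathcal H)$ if and only if $I-A_1(z)\in\mathcal B_p(\mathcal H)$. Here $\mathcal B_p(\mathcal H)$, $p<\infty$, is the Schatten–von Neumann class of compact operators with $p$-summable singular values, and $\mathcal B_\infty(\mathcal H)$ is the space of compact operators. -/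

import Mathlib

open scoped Topology ENNReal

noncomputable section

namespace HowlandFactorization

variable {H : Type*} [NormedAddCommGroup H] [InnerProductSpace ℂ H] [CompleteSpace H]

/-- The operator-valued function `z ↦ A(z)⁻¹`; the value is `A(z)⁻¹ ∈ 𝓑(H)` wherever `A(z)` is
boundedly invertible, and the junk value `0` elsewhere. -/
def inverseFamily (A : ℂ → H →L[ℂ] H) (z : ℂ) : H →L[ℂ] H :=
  Ring.inverse (A z)

/-- `M` has a pole of order `n` at `z₀`: on some punctured disk around `z₀`,
`M(z) = (z - z₀)^(-n) G(z)` with `G` analytic at `z₀` and `G(z₀) ≠ 0`.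
For `n = 0` this says that `z₀` is not a pole: `M` agrees near `z₀`, off `z₀`, with a function
that is analytic (and nonzero) at `z₀`. -/
def HasPoleOfOrder (M : ℂ → H →L[ℂ] H) (z₀ : ℂ) (n : ℕ) : Prop :=
  MeromorphicAt M z₀ ∧ meromorphicOrderAt M z₀ = ((-(n : ℤ) : ℤ) : WithTop ℤ)

/-- The defect `dim (ran S)^⊥` of an operator `S` with closed range
(used for Fredholm operators, where this dimension is finite). -/
def defect (S : H →L[ℂ] H) : ℕ :=
  Module.finrank ℂ (S.range)ᗮ

/-- The ideal of bounded operators of finite rank. -/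
def IsFiniteRank (T : H →L[ℂ] H) : Prop :=
  FiniteDimensional ℂ T.range

/-- The `n`-th singular value (`n = 0, 1, 2, …`, in decreasing order, counting multiplicity) of
`T`, as the operator-norm distance of `T` to the set of operators of rank at most `n`. For compact
`T` on a Hilbert space these are the eigenvalues of `|T|` repeated by multiplicity (followed by
zeros if there are only finitely many positive ones). -/
def singularValue (T : H →L[ℂ] H) (n : ℕ) : ℝ :=
  Metric.infDist T {F : H →L[ℂ] H | LinearMap.rank (F : H →ₗ[ℂ] H) ≤ n}

/-- Membership in the Schatten–von Neumann class `𝓑_p(H)`, `1 ≤ p ≤ ∞`: compact operators whose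
sequence of singular values is in `ℓ^p`. For `p = ∞` the second condition always holds
(the singular values are bounded by `‖T‖`), so that `𝓑_∞(H)` is the space of compact operators. -/
def MemSchatten (p : ℝ≥0∞) (T : H →L[ℂ] H) : Prop :=
  IsCompactOperator T ∧ Memℓp (singularValue T) p

end HowlandFactorization

end

/-!
# Splitting an elementary factor off an analytic Fredholm family

As `ran Q₁ = ran A(z₀)`, the component `P₁ A(z)` vanishes at `z₀`. Dividing it by `z - z₀` gives the
analytic family `A₁(z) = Q₁ A(z) - P₁ (A(z) - A(z₀)) / (z - z₀)` (`reducedFamily`), for which the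
factorization holds by `mul_reducedFamily`. All the other assertions come from three facts.

* `A₁(z) - A(z)` is `P₁` times a bounded operator, hence of finite rank, because `P₁` vanishes on
  the range of finite codimension of `A(z₀)`. So Fredholmness, and `1 - A(z)` being of finite rank
  or in a Schatten class, pass between `A` and `A₁`
  (`isFredholm_of_isFiniteRank_sub`, `MemSchatten.add_isFiniteRank`).
* Since `A(z)⁻¹` has a pole of order `n ≥ 1` at `z₀`, its leading coefficient annihilates
  `ran A(z₀) = ran Q₁`. So multiplication by `Q₁ - (z - z₀) P₁` on the right lowers the order of
  the pole by exactly one (`hasPoleOfOrder_inverseFamily_reducedFamily`).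
* In particular both families are invertible on a punctured disk around `z₀`, and a Fredholm
  operator that is a limit of invertible ones has index zero (`index_eq_zero_of_frequently_isUnit`).
  For index zero the defect is the nullity, and `ker A₁(z₀) ⊆ ker A(z₀)` by the factorization.
-/

namespace HowlandFactorization

open ContinuousLinearMap LinearMap Filter Module

/-! ### Perturbations of finite rank -/

section FiniteRank

variable {H : Type*} [NormedAddCommGroup H] [InnerProductSpace ℂ H]

theorem isFiniteRank_iff_hasFiniteRange {T : H →L[ℂ] H} :
    IsFiniteRank T ↔ (T : H →ₗ[ℂ] H).HasFiniteRange := by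
  rw [hasFiniteRange_iff_range, Submodule.fg_iff_finiteDimensional]
  rfl

theorem IsFiniteRank.add {S T : H →L[ℂ] H} (hS : IsFiniteRank S) (hT : IsFiniteRank T) :
    IsFiniteRank (S + T) :=
  isFiniteRank_iff_hasFiniteRange.2 <|
    (isFiniteRank_iff_hasFiniteRange.1 hS).add (isFiniteRank_iff_hasFiniteRange.1 hT)

theorem IsFiniteRank.neg {T : H →L[ℂ] H} (hT : IsFiniteRank T) : IsFiniteRank (-T) :=
  isFiniteRank_iff_hasFiniteRange.2 (isFiniteRank_iff_hasFiniteRange.1 hT).neg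

theorem IsFiniteRank.mul_right {T : H →L[ℂ] H} (hT : IsFiniteRank T) (S : H →L[ℂ] H) :
    IsFiniteRank (T * S) := by
  have : FiniteDimensional ℂ T.range := hT
  exact Submodule.finiteDimensional_of_le
    (LinearMap.range_comp_le_range (S : H →ₗ[ℂ] H) (T : H →ₗ[ℂ] H))

theorem IsFiniteRank.isCompactOperator {T : H →L[ℂ] H} (hT : IsFiniteRank T) :
    IsCompactOperator T := by
  have : FiniteDimensional ℂ T.range := hT
  have h := (isCompactOperator_id_iff_finiteDimensional (𝕜 := ℂ) (E := T.range)).2 this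
  exact (h.comp_clm T.rangeRestrict).clm_comp T.range.subtypeL

/-- Fredholmness is stable under perturbations of finite rank: a quasi-inverse of `T` is one of
`S`. -/
theorem isFredholm_of_isFiniteRank_sub {S T : H →L[ℂ] H} (hT : T.IsFredholm)
    (h : IsFiniteRank (S - T)) : S.IsFredholm := by
  obtain ⟨V, hV⟩ := hT.exists_isQuasiInverse
  refine IsFredholm.of_isQuasiInverse (v := V) (hV.congr (FiniteRangeSetoid.setoid.refl _) ?_)
  rw [FiniteRangeSetoid.equiv_iff_hasFiniteRange]
  exact isFiniteRank_iff_hasFiniteRange.1 h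

theorem singularValue_nonneg (T : H →L[ℂ] H) (n : ℕ) : 0 ≤ singularValue T n :=
  Metric.infDist_nonneg

/-- Adding an operator of rank `k` to both `T` and its approximants of rank `n` leaves their
distance unchanged. -/
theorem singularValue_add_le (T F : H →L[ℂ] H) [hF : FiniteDimensional ℂ F.range] (n : ℕ) :
    singularValue (T + F) (n + finrank ℂ F.range) ≤ singularValue T n := by
  refine (Metric.le_infDist ⟨0, by simp⟩).2 fun G hG => ?_
  have hmem : G + F ∈ {F' : H →L[ℂ] H | LinearMap.rank (F' : H →ₗ[ℂ] H) ≤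
      ((n + finrank ℂ F.range : ℕ) : Cardinal)} := by
    refine (LinearMap.rank_add_le (G : H →ₗ[ℂ] H) (F : H →ₗ[ℂ] H)).trans ?_
    push_cast
    exact add_le_add hG (finrank_eq_rank ℂ F.range).ge
  refine (Metric.infDist_le_dist_of_mem (x := T + F) hmem).trans_eq ?_
  simp

/-- By `singularValue_add_le`, the singular values of `T + F`, shifted by the rank of `F`, are
dominated by those of `T`. -/
theorem MemSchatten.add_isFiniteRank {p : ℝ≥0∞} (hp : 1 ≤ p) {T F : H →L[ℂ] H}
    (hT : MemSchatten p T) (hF : IsFiniteRank F) : MemSchatten p (T + F) := by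
  refine ⟨hT.1.add hF.isCompactOperator, ?_⟩
  have : FiniteDimensional ℂ F.range := hF
  have hle := singularValue_add_le T F
  set k := finrank ℂ F.range
  rcases eq_or_ne p ∞ with rfl | hp'
  · refine memℓp_infty_iff.2 ⟨‖T + F‖, ?_⟩
    rintro _ ⟨n, rfl⟩
    dsimp only
    rw [Real.norm_of_nonneg (singularValue_nonneg _ _)]
    refine (Metric.infDist_le_dist_of_mem (y := 0) (by simp)).trans_eq ?_
    simp
  · have hpos : 0 < p.toReal := ENNReal.toReal_pos (by positivity) hp'
    refine memℓp_gen ((summable_nat_add_iff k).1 ?_)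
    refine Summable.of_nonneg_of_le (fun n => by positivity) (fun n => ?_)
      ((memℓp_gen_iff hpos).1 hT.2)
    rw [Real.norm_of_nonneg (singularValue_nonneg _ _),
      Real.norm_of_nonneg (singularValue_nonneg _ _)]
    exact Real.rpow_le_rpow (singularValue_nonneg _ _) (hle n) hpos.le

end FiniteRank

/-! ### Index zero and the defect -/

section Index

theorem index_eq_zero_of_bijective {k M N : Type*} [Field k] [AddCommGroup M] [Module k M]
    [AddCommGroup N] [Module k N] {f : M →ₗ[k] N} (hf : Function.Bijective f) : f.index = 0 :=
  LinearEquiv.index_eq_zero (e := LinearEquiv.ofBijective f hf)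

/-- Additivity of the index for the bijection `V U E`: `0 = dim ker V + 0 - dim coker E`. -/
theorem finrank_ker_eq_finrank_quotient_range_of_bijective {k M X : Type*} [Field k]
    [AddCommGroup M] [Module k M] [AddCommGroup X] [Module k X]
    (V : M →ₗ[k] X) (U : M →ₗ[k] M) (E : X →ₗ[k] M) [FiniteDimensional k V.ker]
    [FiniteDimensional k (M ⧸ E.range)] (hV : Function.Surjective V) (hU : Function.Bijective U)
    (hE : Function.Injective E) (h : Function.Bijective (V ∘ₗ U ∘ₗ E)) :
    finrank k V.ker = finrank k (M ⧸ E.range) := by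
  have hkU : U.ker = ⊥ := LinearMap.ker_eq_bot.2 hU.injective
  have hrU : U.range = ⊤ := LinearMap.range_eq_top.2 hU.surjective
  have hkE : E.ker = ⊥ := LinearMap.ker_eq_bot.2 hE
  have hrV : V.range = ⊤ := LinearMap.range_eq_top.2 hV
  have hkUE : (U ∘ₗ E).ker = ⊥ := LinearMap.ker_eq_bot.2 (hU.injective.comp hE)
  have : FiniteDimensional k U.ker := by rw [hkU]; infer_instance
  have : FiniteDimensional k (M ⧸ U.range) := by rw [hrU]; infer_instance
  have : FiniteDimensional k E.ker := by rw [hkE]; infer_instance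
  have : FiniteDimensional k (X ⧸ V.range) := by rw [hrV]; infer_instance
  have : FiniteDimensional k (U ∘ₗ E).ker := by rw [hkUE]; infer_instance
  have : FiniteDimensional k (M ⧸ (U ∘ₗ E).range) := by
    rw [LinearMap.range_comp]; infer_instance
  have h0 := index_eq_zero_of_bijective h
  rw [LinearMap.index_comp, LinearMap.index_comp, index_eq_zero_of_bijective hU,
    LinearMap.index_of_surjective hV, LinearMap.index_of_injective hE] at h0
  omega

theorem index_eq_zero_of_isUnit {X : Type*} [NormedAddCommGroup X] [NormedSpace ℂ X]
    {U : X →L[ℂ] X} (hU : IsUnit U) : (U : X →ₗ[ℂ] X).index = 0 := by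
  obtain ⟨u, rfl⟩ := hU
  exact index_eq_zero_of_bijective (ContinuousLinearEquiv.ofUnit u).bijective

variable {H : Type*} [NormedAddCommGroup H] [InnerProductSpace ℂ H] [CompleteSpace H]

/-- A Fredholm operator that is a limit of invertible operators has index zero. With `V` the
projection onto the essential part of the codomain followed by the inverse of `T` there, and `E`
the inclusion of the essential part `X` of the domain, `V T E = 1` on `X`. So `V U E` is invertible
for `U` close to `T`, and for such an invertible `U` additivity of the index gives
`0 = ind V + ind E = dim coker T - dim ker T`. -/
theorem index_eq_zero_of_frequently_isUnit {T : H →L[ℂ] H} (hT : T.IsFredholm)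
    (h : ∃ᶠ U in 𝓝 T, IsUnit U) : (T : H →ₗ[ℂ] H).index = 0 := by
  obtain ⟨D⟩ := hT.nonempty_fredholmPackage
  have hX : IsClosed (D.decDom.X₁ : Set H) := D.decDom.isTopCompl.isClosed
  have : CompleteSpace D.decDom.X₁ := hX.completeSpace_coe
  let V : H →L[ℂ] D.decDom.X₁ :=
    (D.equiv.symm : D.decCodom.X₁ →L[ℂ] D.decDom.X₁) ∘L D.decCodom.proj
  let E : D.decDom.X₁ →L[ℂ] H := D.decDom.X₁.subtypeL
  have hVTE : V ∘L T ∘L E = 1 := by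
    ext x
    have hTx : T x = D.equiv x := by
      simpa using congr($D.eq_equiv x)
    simp [V, E, hTx]
  have hcont : Continuous fun U : H →L[ℂ] H => V ∘L U ∘L E := by fun_prop
  have hnear : ∀ᶠ U in 𝓝 T, IsUnit (V ∘L U ∘L E) :=
    (Units.isOpen (R := D.decDom.X₁ →L[ℂ] D.decDom.X₁)).preimage hcont |>.mem_nhds (by
      change IsUnit (V ∘L T ∘L E)
      rw [hVTE]
      exact isUnit_one)
  obtain ⟨U, hU, hVUE⟩ := (h.and_eventually hnear).exists
  have hU' : Function.Bijective U := by
    obtain ⟨u, rfl⟩ := hU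
    exact (ContinuousLinearEquiv.ofUnit u).bijective
  have hVUE' : Function.Bijective (V ∘L U ∘L E) := by
    obtain ⟨u, hu⟩ := hVUE
    rw [← hu]
    exact (ContinuousLinearEquiv.ofUnit u).bijective
  have hkV : (V : H →ₗ[ℂ] D.decDom.X₁).ker = D.decCodom.X₀ := by
    simp [V, LinearMap.ker_comp]
  have hsV : Function.Surjective V :=
    D.equiv.symm.surjective.comp
      (Submodule.projectionOntoL_surjective D.decCodom.isTopCompl)
  have hE : Function.Injective E := D.decDom.X₁.injective_subtype
  have hrE : (E : D.decDom.X₁ →ₗ[ℂ] H).range = D.decDom.X₁ := D.decDom.X₁.range_subtype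
  have hqE : (H ⧸ (E : D.decDom.X₁ →ₗ[ℂ] H).range) ≃ₗ[ℂ] D.decDom.X₀ :=
    (Submodule.quotEquivOfEq _ _ hrE).trans
      (D.decDom.X₁.quotientEquivOfIsCompl _ D.decDom.isTopCompl.isCompl)
  have hqT : (H ⧸ T.range) ≃ₗ[ℂ] D.decCodom.X₀ :=
    (Submodule.quotEquivOfEq _ _ D.range_eq).trans
      (D.decCodom.X₁.quotientEquivOfIsCompl _ D.decCodom.isTopCompl.isCompl)
  have := D.decDom.finite_X₀
  have : FiniteDimensional ℂ (V : H →ₗ[ℂ] D.decDom.X₁).ker := hkV ▸ D.decCodom.finite_X₀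
  have : FiniteDimensional ℂ (H ⧸ (E : D.decDom.X₁ →ₗ[ℂ] H).range) :=
    hqE.symm.finiteDimensional
  have key := finrank_ker_eq_finrank_quotient_range_of_bijective
    (V : H →ₗ[ℂ] D.decDom.X₁) (U : H →ₗ[ℂ] H) (E : D.decDom.X₁ →ₗ[ℂ] H) hsV hU' hE hVUE'
  rw [hkV, hqE.finrank_eq] at key
  rw [LinearMap.index_eq_finrank_sub, D.ker_eq, hqT.finrank_eq, key, sub_self]

/-- The defect of an index zero Fredholm operator is its nullity. -/
theorem defect_eq_finrank_ker {T : H →L[ℂ] H} (hT : T.IsFredholm)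
    (h : (T : H →ₗ[ℂ] H).index = 0) : defect T = finrank ℂ T.ker := by
  have : CompleteSpace T.range := hT.isClosed_range.completeSpace_coe
  have h1 : finrank ℂ (H ⧸ T.range) = finrank ℂ (T.range)ᗮ :=
    (T.range.quotientEquivOrthogonal (𝕜 := ℂ)).toLinearEquiv.finrank_eq
  rw [LinearMap.index_eq_finrank_sub] at h
  unfold defect
  omega

theorem eventually_index_eq_zero {A : ℂ → H →L[ℂ] H} {z₀ : ℂ} (hA : ContinuousAt A z₀)
    (hF : (A z₀).IsFredholm) (hu : ∀ᶠ z in 𝓝[≠] z₀, IsUnit (A z)) :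
    ∀ᶠ z in 𝓝 z₀, (A z : H →ₗ[ℂ] H).index = 0 := by
  have h0 : (A z₀ : H →ₗ[ℂ] H).index = 0 :=
    index_eq_zero_of_frequently_isUnit hF
      ((hA.tendsto.mono_left nhdsWithin_le_nhds).frequently hu.frequently)
  filter_upwards [eventually_nhdsWithin_iff.1 hu] with z hz
  rcases eq_or_ne z z₀ with rfl | hne
  · exact h0
  · exact index_eq_zero_of_isUnit (hz hne)

end Index

/-! ### The factorization and the order of the pole -/

section Factorization

variable {H : Type*} [NormedAddCommGroup H] [InnerProductSpace ℂ H]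

theorem analyticOnNhd_dslope {E : Type*} [NormedAddCommGroup E] [NormedSpace ℂ E] [CompleteSpace E]
    {f : ℂ → E} {s : Set ℂ} {z₀ : ℂ} (hs : IsOpen s) (hz₀ : z₀ ∈ s) (hf : AnalyticOnNhd ℂ f s) :
    AnalyticOnNhd ℂ (dslope f z₀) s :=
  DifferentiableOn.analyticOnNhd
    ((Complex.differentiableOn_dslope (hs.mem_nhds hz₀)).2 hf.differentiableOn) hs

theorem analyticAt_dslope {E : Type*} [NormedAddCommGroup E] [NormedSpace ℂ E] [CompleteSpace E]
    {f : ℂ → E} {z₀ : ℂ} (hf : AnalyticAt ℂ f z₀) : AnalyticAt ℂ (dslope f z₀) z₀ := by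
  obtain ⟨s, hs, hz, hfs⟩ := eventually_nhds_iff.1 hf.eventually_analyticAt
  exact analyticOnNhd_dslope hz hfs (fun z hz => hs z hz) z₀ hfs

/-- The kernel of `1 - Q` contains the range of `Q`, which has finite codimension. -/
theorem isFiniteRank_one_sub {Q : H →L[ℂ] H} (hQ : IsIdempotentElem Q) (hc : Q.range.CoFG) :
    IsFiniteRank (1 - Q) := by
  rw [isFiniteRank_iff_hasFiniteRange, ← ker_coFG_iff_hasFiniteRange]
  refine hc.of_le ?_
  rintro _ ⟨x, rfl⟩
  have : Q (Q x) = Q x := congr($hQ x)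
  simp [this]

/-- The quotient of `A` by the elementary factor `Q - (z - z₀)(1 - Q)`: since
`(1 - Q) A(z₀) = 0` when `ran Q = ran A(z₀)`, the component of `A` along `1 - Q` is divisible by
`z - z₀`. The use of `dslope` gives `A'(z₀)` as the value of the quotient at `z₀`. -/
noncomputable def reducedFamily (Q : H →L[ℂ] H) (A : ℂ → H →L[ℂ] H) (z₀ z : ℂ) : H →L[ℂ] H :=
  Q * A z - (1 - Q) * dslope A z₀ z

theorem mul_eq_of_range_le {Q T : H →L[ℂ] H} (hQ : IsIdempotentElem Q) (h : T.range ≤ Q.range) :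
    Q * T = T := by
  ext x
  obtain ⟨y, hy⟩ := h ⟨x, rfl⟩
  have hy : Q y = T x := hy
  have : Q (Q y) = Q y := congr($hQ y)
  simpa [hy] using this

variable {Q : H →L[ℂ] H} {A : ℂ → H →L[ℂ] H} {z₀ : ℂ}

theorem mul_reducedFamily (hQ : IsIdempotentElem Q) (h : Q * A z₀ = A z₀) (z : ℂ) :
    (Q - (z - z₀) • (1 - Q)) * reducedFamily Q A z₀ z = A z := by
  have hQ' : Q * Q = Q := hQ
  have e1 : Q * (1 - Q) = 0 := hQ.mul_one_sub_self
  have e2 : (1 - Q) * Q = 0 := hQ.one_sub_mul_self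
  have e3 : (1 - Q) * (1 - Q) = 1 - Q := hQ.one_sub
  have e4 : (1 - Q) * ((z - z₀) • dslope A z₀ z) = (1 - Q) * A z := by
    rw [sub_smul_dslope, mul_sub, sub_mul 1 Q (A z₀), h, one_mul, sub_self, sub_zero]
  calc _ = Q * Q * A z - Q * (1 - Q) * dslope A z₀ z - (z - z₀) • ((1 - Q) * Q * A z)
        + (1 - Q) * (1 - Q) * ((z - z₀) • dslope A z₀ z) := by
        rw [reducedFamily, sub_mul, mul_sub, mul_sub, smul_mul_assoc, smul_mul_assoc,
          mul_smul_comm, mul_assoc, mul_assoc, mul_assoc, mul_assoc]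
        abel
    _ = A z := by
        rw [hQ', e1, e2, e3, e4, sub_mul 1 Q (A z)]
        simp

/-- The inverse is `Q - w⁻¹ (1 - Q)`. -/
theorem isUnit_factor (hQ : IsIdempotentElem Q) {w : ℂ} (hw : w ≠ 0) :
    IsUnit (Q - w • (1 - Q)) := by
  have hQ' : Q * Q = Q := hQ
  have e1 : Q * (1 - Q) = 0 := hQ.mul_one_sub_self
  have e2 : (1 - Q) * Q = 0 := hQ.one_sub_mul_self
  have e3 : (1 - Q) * (1 - Q) = 1 - Q := hQ.one_sub
  have key : ∀ a b : ℂ, a * b = 1 → (Q - a • (1 - Q)) * (Q - b • (1 - Q)) = 1 := by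
    intro a b hab
    rw [sub_mul, mul_sub, mul_sub, smul_mul_assoc, smul_mul_assoc, mul_smul_comm, mul_smul_comm,
      hQ', e1, e2, e3, smul_smul, hab]
    simp
  exact ⟨⟨_, _, key w w⁻¹ (mul_inv_cancel₀ hw), key w⁻¹ w (inv_mul_cancel₀ hw)⟩, rfl⟩

theorem HasPoleOfOrder.eventually_isUnit [CompleteSpace H] {n : ℕ}
    (h : HasPoleOfOrder (inverseFamily A) z₀ n) : ∀ᶠ z in 𝓝[≠] z₀, IsUnit (A z) := by
  have := (meromorphicOrderAt_ne_top_iff_eventually_ne_zero h.1).1 (by simp [h.2])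
  filter_upwards [this] with z hz
  by_contra hu
  exact hz (Ring.inverse_non_unit _ hu)

/-- Dividing off the elementary factor lowers the order of the pole of the inverse by one. If
`A(z)⁻¹ = (z - z₀)⁻ⁿ G(z)`, then `G(z₀) A(z₀) = 0`, so that `G(z₀) Q = 0` and
`A₁(z)⁻¹ = A(z)⁻¹ (Q - (z - z₀)(1 - Q)) = (z - z₀)¹⁻ⁿ K(z)` with `K` analytic and
`K(z₀)(1 - Q) = -G(z₀) ≠ 0`. -/
theorem hasPoleOfOrder_inverseFamily_reducedFamily [CompleteSpace H] {n : ℕ} (hn : 1 ≤ n)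
    (hA : AnalyticAt ℂ A z₀) (hQ : IsIdempotentElem Q) (hran : Q.range = (A z₀).range)
    (h : HasPoleOfOrder (inverseFamily A) z₀ n) :
    HasPoleOfOrder (inverseFamily (reducedFamily Q A z₀)) z₀ (n - 1) := by
  obtain ⟨G, hG, hG0, hGA⟩ := (meromorphicOrderAt_eq_int_iff h.1).1 h.2
  have hQA : Q * A z₀ = A z₀ := mul_eq_of_range_le hQ hran.ge
  have hGA0 : G z₀ * A z₀ = 0 := by
    have h1 : (fun z => G z * A z) =ᶠ[𝓝[≠] z₀] fun z => (z - z₀) ^ n • (1 : H →L[ℂ] H) := by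
      filter_upwards [hGA, h.eventually_isUnit, self_mem_nhdsWithin] with z hz hu hne
      have hne : z - z₀ ≠ 0 := sub_ne_zero.2 hne
      have h2 : inverseFamily A z * A z = 1 := Ring.inverse_mul_cancel _ hu
      rw [hz, zpow_neg, zpow_natCast, smul_mul_assoc] at h2
      rw [← h2, smul_smul, mul_inv_cancel₀ (pow_ne_zero _ hne), one_smul]
    have h3 : Tendsto (fun z => (z - z₀) ^ n • (1 : H →L[ℂ] H)) (𝓝[≠] z₀) (𝓝 0) := by
      have hc : Continuous fun z => (z - z₀) ^ n • (1 : H →L[ℂ] H) := by fun_prop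
      have := hc.tendsto z₀
      rw [sub_self, zero_pow (by omega), zero_smul] at this
      exact this.mono_left nhdsWithin_le_nhds
    exact tendsto_nhds_unique
      ((hG.mul hA).continuousAt.tendsto.mono_left nhdsWithin_le_nhds) (h3.congr' h1.symm)
  have hGQ : G z₀ * Q = 0 := by
    ext x
    obtain ⟨y, hy⟩ : Q x ∈ (A z₀).range := hran ▸ ⟨x, rfl⟩
    have hy : A z₀ y = Q x := hy
    have : G z₀ (A z₀ y) = 0 := congr($hGA0 y)
    simpa [hy] using this
  let K : ℂ → H →L[ℂ] H := fun z => dslope G z₀ z * Q - G z * (1 - Q)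
  have hK : AnalyticAt ℂ K z₀ :=
    ((analyticAt_dslope hG).mul analyticAt_const).sub (hG.mul analyticAt_const)
  have hK0 : K z₀ ≠ 0 := by
    intro h0
    have h1 : K z₀ * (1 - Q) = - G z₀ := by
      simp only [K]
      rw [sub_mul, mul_assoc, mul_assoc, hQ.mul_one_sub_self, hQ.one_sub.eq, mul_sub, hGQ]
      simp
    rw [h0, zero_mul] at h1
    exact hG0 (neg_eq_zero.1 h1.symm)
  have hinv : inverseFamily (reducedFamily Q A z₀) =ᶠ[𝓝[≠] z₀]
      fun z => (z - z₀) ^ (-((n - 1 : ℕ) : ℤ)) • K z := by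
    filter_upwards [hGA, h.eventually_isUnit, self_mem_nhdsWithin] with z hz hu hne
    have hne : z - z₀ ≠ 0 := sub_ne_zero.2 hne
    have hfac := mul_reducedFamily hQ hQA z
    have hB := isUnit_factor hQ hne
    have hu1 : IsUnit (reducedFamily Q A z₀ z) := by
      rw [← hB.unit.isUnit_units_mul]
      simpa [hfac] using hu
    have h2 : inverseFamily A z * (Q - (z - z₀) • (1 - Q)) * reducedFamily Q A z₀ z = 1 := by
      rw [mul_assoc, hfac]; exact Ring.inverse_mul_cancel _ hu
    have h3 : inverseFamily (reducedFamily Q A z₀) z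
        = inverseFamily A z * (Q - (z - z₀) • (1 - Q)) :=
      (left_inv_eq_right_inv h2 (Ring.mul_inverse_cancel _ hu1)).symm
    have h4 : G z * Q = (z - z₀) • (dslope G z₀ z * Q) := by
      rw [← smul_mul_assoc, sub_smul_dslope, sub_mul, hGQ, sub_zero]
    have h5 : (z - z₀) ^ (-((n - 1 : ℕ) : ℤ)) = (z - z₀) ^ (-(n : ℤ)) * (z - z₀) := by
      rw [← zpow_add_one₀ hne]
      congr 1
      omega
    rw [h3, hz, h5, smul_mul_assoc, mul_sub, h4, mul_smul_comm, ← smul_sub, smul_smul]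
  have hmer : MeromorphicAt (inverseFamily (reducedFamily Q A z₀)) z₀ := by
    refine MeromorphicAt.congr ?_ hinv.symm
    exact ((MeromorphicAt.id z₀).sub (MeromorphicAt.const z₀ z₀)).zpow _ |>.smul hK.meromorphicAt
  exact ⟨hmer, (meromorphicOrderAt_eq_int_iff hmer).2 ⟨K, hK, hK0, hinv⟩⟩

end Factorization

end HowlandFactorization

theorem theorem3p4
    {H : Type*} [NormedAddCommGroup H] [InnerProductSpace ℂ H] [CompleteSpace H]
    [TopologicalSpace.SeparableSpace H]
    (Ω : Set ℂ) (hΩ : IsOpen Ω) (hΩc : IsConnected Ω)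
    (A : ℂ → H →L[ℂ] H) (hA : AnalyticOnNhd ℂ A Ω)
    (hAF : ∀ z ∈ Ω, (A z).IsFredholm)
    (hinv : ∃ z ∈ Ω, IsUnit (A z))
    (z₀ : ℂ) (hz₀ : z₀ ∈ Ω) (n₀ : ℕ) (hn₀ : 1 ≤ n₀)
    (hpole : HowlandFactorization.HasPoleOfOrder
      (HowlandFactorization.inverseFamily A) z₀ n₀)
    (Q₁ P₁ : H →L[ℂ] H) (hQ₁ : IsIdempotentElem Q₁)
    (hQ₁ran : Q₁.range = (A z₀).range) (hP₁ : P₁ = 1 - Q₁) :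
    ∃ A₁ : ℂ → H →L[ℂ] H,
      (∀ z ∈ Ω, A z = (Q₁ - (z - z₀) • P₁) * A₁ z) ∧
      AnalyticOnNhd ℂ A₁ Ω ∧
      (∀ z ∈ Ω, (A₁ z).IsFredholm) ∧
      (∀ᶠ z in 𝓝 z₀, (A z : H →ₗ[ℂ] H).index = 0 ∧ (A₁ z : H →ₗ[ℂ] H).index = 0) ∧
      HowlandFactorization.defect (A₁ z₀) ≤ HowlandFactorization.defect (A z₀) ∧
      HowlandFactorization.HasPoleOfOrder
        (HowlandFactorization.inverseFamily A₁) z₀ (n₀ - 1) ∧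
      (∀ z ∈ Ω, HowlandFactorization.IsFiniteRank (1 - A z) ↔
        HowlandFactorization.IsFiniteRank (1 - A₁ z)) ∧
      (∀ p : ENNReal, 1 ≤ p → ∀ z ∈ Ω, HowlandFactorization.MemSchatten p (1 - A z) ↔
        HowlandFactorization.MemSchatten p (1 - A₁ z)) := by
  open HowlandFactorization in
  subst hP₁
  have hQA : Q₁ * A z₀ = A z₀ := mul_eq_of_range_le hQ₁ hQ₁ran.ge
  have hfac := mul_reducedFamily hQ₁ hQA
  have hP : IsFiniteRank (1 - Q₁) :=
    isFiniteRank_one_sub hQ₁ (hQ₁ran ▸ (hAF z₀ hz₀).finite_coker)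
  have hdiff : ∀ z, IsFiniteRank (reducedFamily Q₁ A z₀ z - A z) := by
    intro z
    have : reducedFamily Q₁ A z₀ z - A z = (1 - Q₁) * -(A z + dslope A z₀ z) := by
      rw [reducedFamily]; noncomm_ring
    rw [this]
    exact hP.mul_right _
  have h1 : ∀ z, 1 - A z = 1 - reducedFamily Q₁ A z₀ z + (reducedFamily Q₁ A z₀ z - A z) := by
    intro z; abel
  have h2 : ∀ z, 1 - reducedFamily Q₁ A z₀ z = 1 - A z + -(reducedFamily Q₁ A z₀ z - A z) := by
    intro z; abel
  have hF : ∀ z ∈ Ω, (reducedFamily Q₁ A z₀ z).IsFredholm := fun z hz =>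
    isFredholm_of_isFiniteRank_sub (hAF z hz) (hdiff z)
  have hA₁ : AnalyticOnNhd ℂ (reducedFamily Q₁ A z₀) Ω :=
    (analyticOnNhd_const.mul hA).sub
      (analyticOnNhd_const.mul (analyticOnNhd_dslope hΩ hz₀ hA))
  have hpole₁ := hasPoleOfOrder_inverseFamily_reducedFamily hn₀ (hA z₀ hz₀) hQ₁ hQ₁ran hpole
  have hi := eventually_index_eq_zero (hA z₀ hz₀).continuousAt (hAF z₀ hz₀) hpole.eventually_isUnit
  have hi₁ := eventually_index_eq_zero (hA₁ z₀ hz₀).continuousAt (hF z₀ hz₀)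
    hpole₁.eventually_isUnit
  refine ⟨reducedFamily Q₁ A z₀, fun z _ => (hfac z).symm, hA₁, hF, hi.and hi₁, ?_, hpole₁,
    fun z _ => ⟨fun h => h2 z ▸ h.add (hdiff z).neg, fun h => h1 z ▸ h.add (hdiff z)⟩,
    fun p hp z _ => ⟨fun h => h2 z ▸ h.add_isFiniteRank hp (hdiff z).neg,
      fun h => h1 z ▸ h.add_isFiniteRank hp (hdiff z)⟩⟩
  rw [defect_eq_finrank_ker (hF z₀ hz₀) hi₁.self_of_nhds,
    defect_eq_finrank_ker (hAF z₀ hz₀) hi.self_of_nhds]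
  have := (hAF z₀ hz₀).finite_ker
  refine Submodule.finrank_mono fun x hx => ?_
  have hx : reducedFamily Q₁ A z₀ z₀ x = 0 := hx
  change A z₀ x = 0
  rw [← hfac z₀]
  simp [hx]
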